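/- Let $N_1,N_2$ be natural numbers, let $\mathcal D$ be the space of density matrices (positive semidefinite, trace one) on $\mathbb C^{N_1}\otimes\mathbb C^{N_2}$, with its topology as a subspace of the space of matrices, and let $K=SU(N_1)\times SU(N_2)$ act on $\mathcal D$ by $(U,V).\rho=(U\otimes V)\rho(U\otimes V)^{*}$. A state $\rho\in\mathcal D$ is a CC state if $\rho=\sum_{i,j}p_{ij}\,|a_i\rangle\langle a_i|\otimes|b_j\rangle\langle b_j|$ for some orthonormal bases $(a_i)$ of $\mathbb C^{N_1}$ and $(b_j)$ of $\mathbb C^{N_2}$ and some probability distribution $(p_{ij})$. Its reduced density matrices are $\rho_1=\mathrm{tr}_2\,\rho$ and $\rho_2=\mathrm{tr}_1\,\rho$; a spectrum is non-degenerate if all eigenvalues are simple. For $\sigma\in\mathcal D$ the tangent space at $\sigma$ to the manifold of density matrices isospectral with $\sigma$ is $\{[X,\sigma]:X\in\mathfrak{su}(N_1N_2)\}$, and the Kirillov-Kostant-Souriau symplectic form on it is $\omega_\sigma([X,\sigma],[Y,\sigma])=-\mathrm{tr}\big(i\sigma[Y,X]\big)$. The orbit $K.\rho$ is called symplectic if at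 each of its points $\sigma$ the restriction of $\omega_\sigma$ to $T_\sigma(K.\rho)=\{[X_1\otimes I+I\otimes X_2,\sigma]:X_1\in\mathfrak{su}(N_1),X_2\in\mathfrak{su}(N_2)\}$ is non-degenerate. Then: 1. For a generic CC state the spectra of $\rho_1$ and $\rho_2$ are both non-degenerate, in the following sense. The CC states with this property form an open and dense subset of the set of all CC states. Moreover, for every fixed pair of orthonormal bases $(a_i)$, $(b_j)$ there are finitely many linear functionals on $\mathbb R^{N_1\times N_2}$, none of which vanishes on the whole probability simplex, such that the CC state in these bases with coefficients $p$ has this property if and only if none of these functionals vanishes at $p$. 2. If $K.\rho$ is symplectic, then it consists only of CC states. 3. The set of all CC states is equal to the closure in $\mathcal D$ of the union of all symplectic $K$-orbits. -/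

import Mathlib

open scoped Kronecker ComplexOrder

noncomputable section

/-! ### Density matrices, CC states, reduced states -/

/-- The space of density matrices on `ℂ^{N₁} ⊗ ℂ^{N₂}` (non-negative, trace one), with the
topology it inherits from the space of all matrices. -/
abbrev DensityMatrix (N₁ N₂ : ℕ) : Type :=
  {ρ : Matrix (Fin N₁ × Fin N₂) (Fin N₁ × Fin N₂) ℂ // ρ.PosSemidef ∧ ρ.trace = 1}

/-- The rank-one projector `|v⟩⟨v|` of a unit vector `v`, as a matrix. -/
def ketBra {n : ℕ} (v : EuclideanSpace ℂ (Fin n)) : Matrix (Fin n) (Fin n) ℂ :=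
  Matrix.of fun r s => v r * star (v s)

/-- The matrix `∑_{i,j} p_{ij} |a_i⟩⟨a_i| ⊗ |b_j⟩⟨b_j|`. -/
def ccMatrix {N₁ N₂ : ℕ}
    (a : OrthonormalBasis (Fin N₁) ℂ (EuclideanSpace ℂ (Fin N₁)))
    (b : OrthonormalBasis (Fin N₂) ℂ (EuclideanSpace ℂ (Fin N₂)))
    (p : Fin N₁ × Fin N₂ → ℝ) :
    Matrix (Fin N₁ × Fin N₂) (Fin N₁ × Fin N₂) ℂ :=
  ∑ i, ∑ j, p (i, j) • (ketBra (a i) ⊗ₖ ketBra (b j))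

/-- The set of classical-classical states: the density matrices
`∑_{i,j} p_{ij} |a_i⟩⟨a_i| ⊗ |b_j⟩⟨b_j|` with `a`, `b` orthonormal bases of the two factors and
`p` a probability distribution. -/
def ccStates (N₁ N₂ : ℕ) : Set (DensityMatrix N₁ N₂) :=
  {ρ | ∃ (a : OrthonormalBasis (Fin N₁) ℂ (EuclideanSpace ℂ (Fin N₁)))
      (b : OrthonormalBasis (Fin N₂) ℂ (EuclideanSpace ℂ (Fin N₂))),
      ∃ p ∈ stdSimplex ℝ (Fin N₁ × Fin N₂), ρ.1 = ccMatrix a b p}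

/-- The reduced matrix `ρ₁ = tr₂ ρ`. -/
def reducedFst {N₁ N₂ : ℕ} (ρ : Matrix (Fin N₁ × Fin N₂) (Fin N₁ × Fin N₂) ℂ) :
    Matrix (Fin N₁) (Fin N₁) ℂ :=
  Matrix.of fun i i' => ∑ j, ρ (i, j) (i', j)

/-- The reduced matrix `ρ₂ = tr₁ ρ`. -/
def reducedSnd {N₁ N₂ : ℕ} (ρ : Matrix (Fin N₁ × Fin N₂) (Fin N₁ × Fin N₂) ℂ) :
    Matrix (Fin N₂) (Fin N₂) ℂ :=
  Matrix.of fun j j' => ∑ i, ρ (i, j) (i, j')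

/-- A complex matrix has non-degenerate spectrum when all its eigenvalues are simple. -/
def HasNondegenerateSpectrum {n : ℕ} (A : Matrix (Fin n) (Fin n) ℂ) : Prop :=
  A.charpoly.roots.Nodup

/-- Both reduced matrices of `ρ` have non-degenerate spectra. -/
def HasNondegenerateMarginals {N₁ N₂ : ℕ}
    (ρ : Matrix (Fin N₁ × Fin N₂) (Fin N₁ × Fin N₂) ℂ) : Prop :=
  HasNondegenerateSpectrum (reducedFst ρ) ∧ HasNondegenerateSpectrum (reducedSnd ρ)

/-! ### The Kirillov-Kostant-Souriau form -/

section KKS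

variable {n : Type*} [Fintype n]

/-- The Lie algebra of the special unitary group: traceless anti-hermitian matrices. -/
def suAlg (n : Type*) [Fintype n] : Submodule ℝ (Matrix n n ℂ) where
  carrier := {X | X.conjTranspose = -X ∧ X.trace = 0}
  add_mem' := by
    rintro X Y ⟨hX, hX'⟩ ⟨hY, hY'⟩
    refine ⟨?_, ?_⟩
    · rw [Matrix.conjTranspose_add, hX, hY, neg_add]
    · rw [Matrix.trace_add, hX', hY', add_zero]
  zero_mem' := by simp
  smul_mem' := by
    rintro c X ⟨hX, hX'⟩
    refine ⟨?_, ?_⟩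
    · rw [Matrix.conjTranspose_smul, hX, star_trivial, smul_neg]
    · rw [Matrix.trace_smul, hX', smul_zero]

/-- The pairing `(X | Y) = -tr (X Y)`, which takes real values on anti-hermitian matrices. -/
def invPairing (X Y : Matrix n n ℂ) : ℝ := -(X * Y).trace.re

/-- The value at `σ` of the fundamental vector field of `X`, that is `[X, σ]`. -/
def fundVec (σ : Matrix n n ℂ) : Matrix n n ℂ →ₗ[ℝ] Matrix n n ℂ where
  toFun X := X * σ - σ * X
  map_add' X Y := by rw [add_mul, mul_add]; abel
  map_smul' c X := by simp [smul_sub]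

/-- The tangent space at `σ` of the orbit of `σ` under conjugation by the full special unitary
group: the vectors `[X, σ]` with `X` traceless anti-hermitian. -/
def isoTangent (σ : Matrix n n ℂ) : Submodule ℝ (Matrix n n ℂ) :=
  LinearMap.range ((fundVec σ).domRestrict (suAlg n))

/-- The bilinear form `(X, Y) ↦ (iσ | [Y, X])` on the Lie algebra. -/
def kksLie (σ : Matrix n n ℂ) : LinearMap.BilinForm ℝ (suAlg n) :=
  LinearMap.mk₂ ℝ
    (fun X Y => invPairing (Complex.I • σ) ((Y : Matrix n n ℂ) * X - (X : Matrix n n ℂ) * Y))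
    (by intro X X' Y; simp [invPairing, mul_add, add_mul, mul_sub]; ring)
    (by intro c X Y; simp [invPairing, mul_sub]; ring)
    (by intro X Y Y'; simp [invPairing, mul_add, add_mul, mul_sub]; ring)
    (by intro c X Y; simp [invPairing, mul_sub]; ring)

theorem exists_lift (σ : Matrix n n ℂ) :
    ∃ s : isoTangent σ →ₗ[ℝ] suAlg n,
      ((fundVec σ).domRestrict (suAlg n)).rangeRestrict ∘ₗ s = LinearMap.id :=
  LinearMap.exists_rightInverse_of_surjective _ (LinearMap.range_rangeRestrict _)

/-- A linear choice of `X` with `[X, σ] = v` for each tangent vector `v`. -/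
def liftVec (σ : Matrix n n ℂ) : isoTangent σ →ₗ[ℝ] suAlg n := (exists_lift σ).choose

/-- The Kirillov-Kostant-Souriau form at `σ`, a bilinear form on the tangent space at `σ` of the
manifold of matrices isospectral with `σ`:  `ω_σ([X, σ], [Y, σ]) = (iσ | [Y, X])`. It does not
depend on the choice of `X` and `Y`, see `kksForm_apply`. -/
def kksForm (σ : Matrix n n ℂ) : LinearMap.BilinForm ℝ (isoTangent σ) :=
  (kksLie σ).compl₁₂ (liftVec σ) (liftVec σ)

theorem kksLie_eq (σ : Matrix n n ℂ) (X Y : suAlg n) :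
    kksLie σ X Y = -(Complex.I * ((Y : Matrix n n ℂ) * fundVec σ X).trace).re := by
  have h1 : (σ * ((Y : Matrix n n ℂ) * X)).trace = (Y * (X * σ)).trace := by
    rw [Matrix.trace_mul_comm, mul_assoc]
  have h2 : (σ * ((X : Matrix n n ℂ) * Y)).trace = (Y * (σ * X)).trace := by
    rw [← mul_assoc, Matrix.trace_mul_comm]
  simp [kksLie, invPairing, fundVec, mul_sub, h1, h2]

theorem kksLie_antisymm (σ : Matrix n n ℂ) (X Y : suAlg n) : kksLie σ X Y = -kksLie σ Y X := by
  simp [kksLie, invPairing, mul_sub]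

theorem kksLie_congr (σ : Matrix n n ℂ) {X X' Y Y' : suAlg n}
    (hX : fundVec σ X = fundVec σ X') (hY : fundVec σ Y = fundVec σ Y') :
    kksLie σ X Y = kksLie σ X' Y' := by
  rw [kksLie_eq, hX, ← kksLie_eq, kksLie_antisymm, kksLie_eq, hY, ← kksLie_eq,
    ← kksLie_antisymm]

/-- The defining formula of the form, valid for all choices of `X` and `Y`. -/
theorem kksForm_apply (σ : Matrix n n ℂ) (X Y : suAlg n) (v w : isoTangent σ)
    (hv : (v : Matrix n n ℂ) = fundVec σ X) (hw : (w : Matrix n n ℂ) = fundVec σ Y) :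
    kksForm σ v w = invPairing (Complex.I • σ)
      ((Y : Matrix n n ℂ) * X - (X : Matrix n n ℂ) * Y) := by
  have hs : ∀ u : isoTangent σ, fundVec σ (liftVec σ u) = u := fun u =>
    congrArg Subtype.val (LinearMap.congr_fun (exists_lift σ).choose_spec u)
  exact kksLie_congr σ ((hs v).trans hv) ((hs w).trans hw)

end KKS

/-! ### Local unitary orbits -/

/-- The orbit of a density matrix `ρ` under `SU(N₁) × SU(N₂)`, acting by conjugation with
`U ⊗ V`. -/
def localOrbit {N₁ N₂ : ℕ} (ρ : DensityMatrix N₁ N₂) : Set (DensityMatrix N₁ N₂) :=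
  {σ | ∃ U ∈ Matrix.specialUnitaryGroup (Fin N₁) ℂ,
      ∃ V ∈ Matrix.specialUnitaryGroup (Fin N₂) ℂ,
        σ.1 = (U ⊗ₖ V) * ρ.1 * (U ⊗ₖ V).conjTranspose}

/-- The Lie algebra of `SU(N₁) × SU(N₂)` in its representation on `ℂ^{N₁} ⊗ ℂ^{N₂}`: the matrices
`X₁ ⊗ 1 + 1 ⊗ X₂` with `X₁`, `X₂` traceless anti-hermitian. -/
def localAlg (N₁ N₂ : ℕ) : Submodule ℝ (Matrix (Fin N₁ × Fin N₂) (Fin N₁ × Fin N₂) ℂ) where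
  carrier := {X | ∃ X₁ ∈ suAlg (Fin N₁), ∃ X₂ ∈ suAlg (Fin N₂),
    X = X₁ ⊗ₖ (1 : Matrix (Fin N₂) (Fin N₂) ℂ) + (1 : Matrix (Fin N₁) (Fin N₁) ℂ) ⊗ₖ X₂}
  add_mem' := by
    rintro _ _ ⟨X₁, h₁, X₂, h₂, rfl⟩ ⟨Y₁, k₁, Y₂, k₂, rfl⟩
    refine ⟨X₁ + Y₁, add_mem h₁ k₁, X₂ + Y₂, add_mem h₂ k₂, ?_⟩
    rw [Matrix.add_kronecker, Matrix.kronecker_add]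
    abel
  zero_mem' := ⟨0, zero_mem _, 0, zero_mem _, by simp⟩
  smul_mem' := by
    rintro c _ ⟨X₁, h₁, X₂, h₂, rfl⟩
    refine ⟨c • X₁, Submodule.smul_mem _ c h₁, c • X₂, Submodule.smul_mem _ c h₂, ?_⟩
    rw [Matrix.smul_kronecker, Matrix.kronecker_smul, smul_add]

theorem localAlg_le (N₁ N₂ : ℕ) : localAlg N₁ N₂ ≤ suAlg (Fin N₁ × Fin N₂) := by
  rintro _ ⟨X₁, ⟨h₁, t₁⟩, X₂, ⟨h₂, t₂⟩, rfl⟩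
  refine ⟨?_, ?_⟩
  · rw [Matrix.conjTranspose_add, Matrix.conjTranspose_kronecker, Matrix.conjTranspose_kronecker,
      h₁, h₂, Matrix.conjTranspose_one, Matrix.conjTranspose_one, neg_add]
    ext ⟨i, j⟩ ⟨i', j'⟩
    simp [Matrix.kroneckerMap_apply]
  · rw [Matrix.trace_add, Matrix.trace_kronecker, Matrix.trace_kronecker, t₁, t₂, zero_mul,
      mul_zero, add_zero]

/-- The tangent space at `σ` of its `SU(N₁) × SU(N₂)`-orbit: the vectors `[X, σ]` with `X` in the
Lie algebra of `SU(N₁) × SU(N₂)`. -/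
def localTangent {N₁ N₂ : ℕ} (σ : DensityMatrix N₁ N₂) :
    Submodule ℝ (Matrix (Fin N₁ × Fin N₂) (Fin N₁ × Fin N₂) ℂ) :=
  (localAlg N₁ N₂).map (fundVec σ.1)

theorem localTangent_le {N₁ N₂ : ℕ} (σ : DensityMatrix N₁ N₂) :
    localTangent σ ≤ isoTangent σ.1 := by
  rintro _ ⟨X, hX, rfl⟩
  exact ⟨⟨X, localAlg_le N₁ N₂ hX⟩, rfl⟩

/-- The `SU(N₁) × SU(N₂)`-orbit of `ρ` is symplectic when the restriction to it of the
Kirillov-Kostant-Souriau form is non-degenerate at every point. (The restriction of a closed form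
is always closed.) -/
def IsSymplecticOrbit {N₁ N₂ : ℕ} (ρ : DensityMatrix N₁ N₂) : Prop :=
  ∀ σ ∈ localOrbit ρ,
    ((kksForm σ.1).restrict ((localTangent σ).submoduleOf (isoTangent σ.1))).Nondegenerate

end

/-!
The bracket of two local generators `X₁ ⊗ 1 + 1 ⊗ X₂` is again local, so the restriction of the
Kirillov-Kostant-Souriau form to the tangent space of a local orbit at `σ` depends on `σ` only
through its reduced matrices `σ₁`, `σ₂`. A vector `[X, σ]` lies in the kernel exactly when
`[X₁, σ₁] = 0` and `[X₂, σ₂] = 0`. Hence the form is non-degenerate at `σ` if and only if every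
local generator that fixes both reduced matrices also fixes `σ` (`nondegenerate_restrict_iff`).

If this holds, take eigenbases of `σ₁` and `σ₂`. All local generators that are diagonal in these
bases fix the reduced matrices, so they commute with `σ`, which forces `σ` to be diagonal in the
product basis: `σ` is a CC state (`mem_ccStates_of_commute`). Conversely, if `σ` is a CC state whose
reduced matrices have simple spectra, a local generator fixing them is diagonal in the same bases as
`σ`, hence commutes with `σ` (`commute_ccOfUnitary_of_commute_reduced`). The orbit of `σ` consists of
states of the same kind, so it is symplectic.

The eigenvalues of the reduced matrices of a CC state are the marginals of its distribution `p`
(`hasNondegenerateMarginals_ccOfUnitary`), so degeneracy is a condition on `p` alone: `p` lies on one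
of the hyperplanes on which two entries of a marginal agree. By compactness of the unitary groups,
the degenerate CC states form a closed set, and so do all CC states. Moving `p` slightly towards a
distribution with injective marginals shows that the non-degenerate CC states are dense among the CC
states, which also gives the description of the CC states as a closure.
-/

noncomputable section

open Matrix

/-! ### Partial traces -/

section PartialTrace

variable {N₁ N₂ : ℕ}

theorem trace_reducedFst (M : Matrix (Fin N₁ × Fin N₂) (Fin N₁ × Fin N₂) ℂ) :
    (reducedFst M).trace = M.trace := by
  simp [reducedFst, Matrix.trace, Fintype.sum_prod_type]

theorem trace_reducedSnd (M : Matrix (Fin N₁ × Fin N₂) (Fin N₁ × Fin N₂) ℂ) :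
    (reducedSnd M).trace = M.trace := by
  simp [reducedSnd, Matrix.trace, Fintype.sum_prod_type_right]

theorem reducedFst_add (M M' : Matrix (Fin N₁ × Fin N₂) (Fin N₁ × Fin N₂) ℂ) :
    reducedFst (M + M') = reducedFst M + reducedFst M' := by
  ext; simp [reducedFst, Finset.sum_add_distrib]

theorem reducedSnd_add (M M' : Matrix (Fin N₁ × Fin N₂) (Fin N₁ × Fin N₂) ℂ) :
    reducedSnd (M + M') = reducedSnd M + reducedSnd M' := by
  ext; simp [reducedSnd, Finset.sum_add_distrib]

theorem reducedFst_sub (M M' : Matrix (Fin N₁ × Fin N₂) (Fin N₁ × Fin N₂) ℂ) :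
    reducedFst (M - M') = reducedFst M - reducedFst M' := by
  ext; simp [reducedFst, Finset.sum_sub_distrib]

theorem reducedSnd_sub (M M' : Matrix (Fin N₁ × Fin N₂) (Fin N₁ × Fin N₂) ℂ) :
    reducedSnd (M - M') = reducedSnd M - reducedSnd M' := by
  ext; simp [reducedSnd, Finset.sum_sub_distrib]

theorem reducedFst_kronecker_one_mul (A : Matrix (Fin N₁) (Fin N₁) ℂ)
    (M : Matrix (Fin N₁ × Fin N₂) (Fin N₁ × Fin N₂) ℂ) :
    reducedFst ((A ⊗ₖ 1) * M) = A * reducedFst M := by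
  ext i i'
  simp only [reducedFst, of_apply, mul_apply, kronecker_apply, Fintype.sum_prod_type, one_apply,
    mul_ite, mul_one, mul_zero, ite_mul, zero_mul, Finset.sum_ite_eq, Finset.mem_univ, if_true,
    Finset.mul_sum]
  exact Finset.sum_comm

theorem reducedFst_mul_kronecker_one (A : Matrix (Fin N₁) (Fin N₁) ℂ)
    (M : Matrix (Fin N₁ × Fin N₂) (Fin N₁ × Fin N₂) ℂ) :
    reducedFst (M * (A ⊗ₖ 1)) = reducedFst M * A := by
  ext i i'
  simp only [reducedFst, of_apply, mul_apply, kronecker_apply, Fintype.sum_prod_type, one_apply,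
    mul_ite, mul_one, mul_zero, Finset.sum_ite_eq', Finset.mem_univ, if_true,
    Finset.sum_mul]
  exact Finset.sum_comm

/-- The partial trace over the second factor is cyclic for operators on the second factor. -/
theorem reducedFst_one_kronecker_mul (B : Matrix (Fin N₂) (Fin N₂) ℂ)
    (M : Matrix (Fin N₁ × Fin N₂) (Fin N₁ × Fin N₂) ℂ) :
    reducedFst ((1 ⊗ₖ B) * M) = reducedFst (M * (1 ⊗ₖ B)) := by
  ext i i'
  simp only [reducedFst, of_apply, mul_apply, kronecker_apply, Fintype.sum_prod_type_right,
    one_apply, mul_ite, ite_mul, zero_mul, one_mul, mul_zero, Finset.sum_ite_eq,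
    Finset.sum_ite_eq', Finset.mem_univ, if_true]
  rw [Finset.sum_comm]
  simp only [mul_comm]

theorem reducedSnd_one_kronecker_mul (B : Matrix (Fin N₂) (Fin N₂) ℂ)
    (M : Matrix (Fin N₁ × Fin N₂) (Fin N₁ × Fin N₂) ℂ) :
    reducedSnd ((1 ⊗ₖ B) * M) = B * reducedSnd M := by
  ext i i'
  simp only [reducedSnd, of_apply, mul_apply, kronecker_apply, Fintype.sum_prod_type_right,
    one_apply, one_mul, ite_mul, zero_mul, Finset.sum_ite_eq, Finset.mem_univ, if_true,
    Finset.mul_sum]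
  exact Finset.sum_comm

theorem reducedSnd_mul_one_kronecker (B : Matrix (Fin N₂) (Fin N₂) ℂ)
    (M : Matrix (Fin N₁ × Fin N₂) (Fin N₁ × Fin N₂) ℂ) :
    reducedSnd (M * (1 ⊗ₖ B)) = reducedSnd M * B := by
  ext i i'
  simp only [reducedSnd, of_apply, mul_apply, kronecker_apply, Fintype.sum_prod_type_right,
    one_apply, mul_ite, ite_mul, zero_mul, one_mul, mul_zero, Finset.sum_ite_eq', Finset.mem_univ,
    if_true, Finset.sum_mul]
  exact Finset.sum_comm

/-- The partial trace over the first factor is cyclic for operators on the first factor. -/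
theorem reducedSnd_kronecker_one_mul (A : Matrix (Fin N₁) (Fin N₁) ℂ)
    (M : Matrix (Fin N₁ × Fin N₂) (Fin N₁ × Fin N₂) ℂ) :
    reducedSnd ((A ⊗ₖ 1) * M) = reducedSnd (M * (A ⊗ₖ 1)) := by
  ext i i'
  simp only [reducedSnd, of_apply, mul_apply, kronecker_apply, Fintype.sum_prod_type,
    one_apply, mul_ite, ite_mul, zero_mul, mul_one, mul_zero, Finset.sum_ite_eq,
    Finset.sum_ite_eq', Finset.mem_univ, if_true]
  rw [Finset.sum_comm]
  simp only [mul_comm]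

theorem conjTranspose_reducedFst (M : Matrix (Fin N₁ × Fin N₂) (Fin N₁ × Fin N₂) ℂ) :
    (reducedFst M)ᴴ = reducedFst Mᴴ := by
  ext; simp [reducedFst]

theorem conjTranspose_reducedSnd (M : Matrix (Fin N₁ × Fin N₂) (Fin N₁ × Fin N₂) ℂ) :
    (reducedSnd M)ᴴ = reducedSnd Mᴴ := by
  ext; simp [reducedSnd]

theorem reducedFst_fundVec (X₁ : Matrix (Fin N₁) (Fin N₁) ℂ) (X₂ : Matrix (Fin N₂) (Fin N₂) ℂ)
    (σ : Matrix (Fin N₁ × Fin N₂) (Fin N₁ × Fin N₂) ℂ) :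
    reducedFst (fundVec σ (X₁ ⊗ₖ 1 + 1 ⊗ₖ X₂)) = fundVec (reducedFst σ) X₁ := by
  simp only [fundVec, LinearMap.coe_mk, AddHom.coe_mk, add_mul, mul_add, reducedFst_add,
    reducedFst_sub, reducedFst_kronecker_one_mul, reducedFst_mul_kronecker_one,
    reducedFst_one_kronecker_mul]
  abel

theorem reducedSnd_fundVec (X₁ : Matrix (Fin N₁) (Fin N₁) ℂ) (X₂ : Matrix (Fin N₂) (Fin N₂) ℂ)
    (σ : Matrix (Fin N₁ × Fin N₂) (Fin N₁ × Fin N₂) ℂ) :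
    reducedSnd (fundVec σ (X₁ ⊗ₖ 1 + 1 ⊗ₖ X₂)) = fundVec (reducedSnd σ) X₂ := by
  simp only [fundVec, LinearMap.coe_mk, AddHom.coe_mk, add_mul, mul_add, reducedSnd_add,
    reducedSnd_sub, reducedSnd_one_kronecker_mul, reducedSnd_mul_one_kronecker,
    reducedSnd_kronecker_one_mul]
  abel

/-- The partial traces are adjoint to the inclusions of the two factors for the trace pairing. -/
theorem trace_local_mul (Y₁ : Matrix (Fin N₁) (Fin N₁) ℂ) (Y₂ : Matrix (Fin N₂) (Fin N₂) ℂ)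
    (Z : Matrix (Fin N₁ × Fin N₂) (Fin N₁ × Fin N₂) ℂ) :
    ((Y₁ ⊗ₖ 1 + 1 ⊗ₖ Y₂) * Z).trace =
      (Y₁ * reducedFst Z).trace + (Y₂ * reducedSnd Z).trace := by
  rw [add_mul, trace_add, ← reducedFst_kronecker_one_mul, trace_reducedFst,
    ← reducedSnd_one_kronecker_mul, trace_reducedSnd]

end PartialTrace

/-! ### Non-degeneracy of the restricted form -/

section Symplectic

variable {N₁ N₂ : ℕ}

theorem fundVec_apply {n : Type*} [Fintype n] (σ X : Matrix n n ℂ) :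
    fundVec σ X = X * σ - σ * X := rfl

theorem fundVec_eq_zero_iff {n : Type*} [Fintype n] {σ X : Matrix n n ℂ} :
    fundVec σ X = 0 ↔ Commute X σ := by
  rw [fundVec_apply, sub_eq_zero]; rfl

/-- Under the trace pairing, only `0` among the commutators `[X, A]` with `A` hermitian
is orthogonal to the whole Lie algebra: `[X, A]` is hermitian, so it can be tested
against `i [X, A]`. -/
theorem fundVec_eq_zero_of_forall_trace {n : Type*} [Fintype n] {A X : Matrix n n ℂ}
    (hA : A.IsHermitian) (hX : X ∈ suAlg n)
    (h : ∀ Y ∈ suAlg n, (Complex.I * (Y * fundVec A X).trace).re = 0) : fundVec A X = 0 := by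
  have hZ : (fundVec A X)ᴴ = fundVec A X := by
    simp only [fundVec_apply, conjTranspose_sub, conjTranspose_mul, hA.eq, hX.1, mul_neg, neg_mul]
    abel
  have hY : Complex.I • fundVec A X ∈ suAlg n := by
    refine ⟨by simp [conjTranspose_smul, hZ], ?_⟩
    rw [trace_smul, fundVec_apply, trace_sub, trace_mul_comm, sub_self, smul_zero]
  have key := h _ hY
  have hre : ((fundVec A X)ᴴ * fundVec A X).trace.re = 0 := by
    rw [hZ]
    rw [smul_mul_assoc, trace_smul, smul_eq_mul, ← mul_assoc, Complex.I_mul_I] at key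
    simpa using key
  have him : ((fundVec A X)ᴴ * fundVec A X).trace.im = 0 :=
    ((Complex.nonneg_iff.mp (posSemidef_conjTranspose_mul_self (fundVec A X)).trace_nonneg).2).symm
  exact trace_conjTranspose_mul_self_eq_zero_iff.mp (Complex.ext hre him)

/-- The restriction of the Kirillov-Kostant-Souriau form to the local orbit is non-degenerate at
`σ` exactly when every local infinitesimal unitary that fixes both reduced matrices fixes `σ`:
the kernel of the form consists of the directions in which the reduced matrices do not move. -/
theorem nondegenerate_restrict_iff (σ : DensityMatrix N₁ N₂) :
    ((kksForm σ.1).restrict ((localTangent σ).submoduleOf (isoTangent σ.1))).Nondegenerate ↔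
      ∀ X₁ ∈ suAlg (Fin N₁), ∀ X₂ ∈ suAlg (Fin N₂), Commute X₁ (reducedFst σ.1) →
        Commute X₂ (reducedSnd σ.1) → Commute (X₁ ⊗ₖ 1 + 1 ⊗ₖ X₂) σ.1 := by
  have hσ : σ.1.IsHermitian := σ.2.1.isHermitian
  have hval : ∀ (v w : isoTangent σ.1) (X Y : suAlg (Fin N₁ × Fin N₂)),
      v.1 = fundVec σ.1 X → w.1 = fundVec σ.1 Y →
      kksForm σ.1 v w = -(Complex.I * ((Y : Matrix _ _ ℂ) * v.1).trace).re := by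
    intro v w X Y hv hw
    rw [hv, ← kksLie_eq, kksForm_apply σ.1 X Y v w hv hw]
    rfl
  have hanti : ∀ v w : isoTangent σ.1, kksForm σ.1 v w = -kksForm σ.1 w v :=
    fun v w => kksLie_antisymm σ.1 _ _
  constructor
  · intro h X₁ hX₁ X₂ hX₂ h₁ h₂
    have hX : X₁ ⊗ₖ 1 + 1 ⊗ₖ X₂ ∈ localAlg N₁ N₂ := ⟨X₁, hX₁, X₂, hX₂, rfl⟩
    have hv : fundVec σ.1 (X₁ ⊗ₖ 1 + 1 ⊗ₖ X₂) ∈ localTangent σ := ⟨_, hX, rfl⟩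
    rw [← fundVec_eq_zero_iff] at h₁ h₂ ⊢
    have := h.1 ⟨⟨_, localTangent_le σ hv⟩, hv⟩ ?_
    · exact congrArg (fun u => u.1.1) this
    · rintro ⟨⟨w, hw⟩, ⟨_, ⟨Y₁, hY₁, Y₂, hY₂, rfl⟩, hY⟩⟩
      have hYm : Y₁ ⊗ₖ 1 + 1 ⊗ₖ Y₂ ∈ localAlg N₁ N₂ := ⟨Y₁, hY₁, Y₂, hY₂, rfl⟩
      refine (hval ⟨_, localTangent_le σ hv⟩ _ ⟨_, localAlg_le _ _ hX⟩ ⟨_, localAlg_le _ _ hYm⟩ rfl hY.symm).trans ?_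
      rw [trace_local_mul, reducedFst_fundVec, reducedSnd_fundVec, h₁, h₂]
      simp
  · intro h
    -- The form is antisymmetric, so it is enough to separate points on the left.
    suffices hleft : ((kksForm σ.1).restrict
        ((localTangent σ).submoduleOf (isoTangent σ.1))).SeparatingLeft from
      ⟨hleft, fun w hw => hleft w fun v => (hanti w.1 v.1).trans (neg_eq_zero.mpr (hw v))⟩
    rintro ⟨⟨v, hv'⟩, ⟨_, ⟨X₁, hX₁, X₂, hX₂, rfl⟩, hX⟩⟩ hker
    have hXm : X₁ ⊗ₖ 1 + 1 ⊗ₖ X₂ ∈ localAlg N₁ N₂ := ⟨X₁, hX₁, X₂, hX₂, rfl⟩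
    obtain rfl : fundVec σ.1 (X₁ ⊗ₖ 1 + 1 ⊗ₖ X₂) = v := hX
    have hpair : ∀ Y₁ ∈ suAlg (Fin N₁), ∀ Y₂ ∈ suAlg (Fin N₂),
        (Complex.I * ((Y₁ * fundVec (reducedFst σ.1) X₁).trace +
          (Y₂ * fundVec (reducedSnd σ.1) X₂).trace)).re = 0 := by
      intro Y₁ hY₁ Y₂ hY₂
      have hYm : Y₁ ⊗ₖ 1 + 1 ⊗ₖ Y₂ ∈ localAlg N₁ N₂ := ⟨Y₁, hY₁, Y₂, hY₂, rfl⟩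
      have hw : fundVec σ.1 (Y₁ ⊗ₖ 1 + 1 ⊗ₖ Y₂) ∈ localTangent σ := ⟨_, hYm, rfl⟩
      have h0 := hker ⟨⟨_, localTangent_le σ hw⟩, hw⟩
      have h1 := (hval ⟨_, hv'⟩ ⟨_, localTangent_le σ hw⟩ ⟨_, localAlg_le _ _ hXm⟩
        ⟨_, localAlg_le _ _ hYm⟩ rfl rfl).symm.trans h0
      rwa [neg_eq_zero, trace_local_mul, reducedFst_fundVec, reducedSnd_fundVec] at h1
    have h₁ : fundVec (reducedFst σ.1) X₁ = 0 :=
      fundVec_eq_zero_of_forall_trace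
        ((conjTranspose_reducedFst _).trans (congrArg reducedFst hσ.eq)) hX₁
        fun Y hY => by simpa using hpair Y hY 0 (zero_mem _)
    have h₂ : fundVec (reducedSnd σ.1) X₂ = 0 :=
      fundVec_eq_zero_of_forall_trace
        ((conjTranspose_reducedSnd _).trans (congrArg reducedSnd hσ.eq)) hX₂
        fun Y hY => by simpa using hpair 0 (zero_mem _) Y hY
    have h0 := fundVec_eq_zero_iff.mpr
      (h X₁ hX₁ X₂ hX₂ (fundVec_eq_zero_iff.mp h₁) (fundVec_eq_zero_iff.mp h₂))
    exact Subtype.ext (Subtype.ext h0)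

end Symplectic

/-! ### CC states in terms of unitary matrices -/

section Unitaries

variable {n : Type*} [Fintype n] [DecidableEq n] {N₁ N₂ : ℕ}

/-- Conjugation `A ↦ U A U*` by a unitary matrix. -/
abbrev unitaryConj (U : unitaryGroup n ℂ) : Matrix n n ℂ ≃⋆ₐ[ℂ] Matrix n n ℂ :=
  Unitary.conjStarAlgAut ℂ (Matrix n n ℂ) U

/-- The unitary matrix `U ⊗ V`. -/
def unitaryKronecker (U : unitaryGroup (Fin N₁) ℂ) (V : unitaryGroup (Fin N₂) ℂ) :
    unitaryGroup (Fin N₁ × Fin N₂) ℂ :=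
  ⟨U.1 ⊗ₖ V.1, kronecker_mem_unitary U.2 V.2⟩

theorem unitaryKronecker_mul (U U' : unitaryGroup (Fin N₁) ℂ) (V V' : unitaryGroup (Fin N₂) ℂ) :
    unitaryKronecker (U * U') (V * V') = unitaryKronecker U V * unitaryKronecker U' V' :=
  Subtype.ext (mul_kronecker_mul _ _ _ _)

/-- The matrix `(U ⊗ V) diag(p) (U ⊗ V)*`. -/
def ccOfUnitary (U : unitaryGroup (Fin N₁) ℂ) (V : unitaryGroup (Fin N₂) ℂ)
    (p : Fin N₁ × Fin N₂ → ℝ) : Matrix (Fin N₁ × Fin N₂) (Fin N₁ × Fin N₂) ℂ :=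
  unitaryConj (unitaryKronecker U V) (diagonal fun k => (p k : ℂ))

/-- The unitary matrix whose columns are the vectors of an orthonormal basis. -/
def unitaryOfBasis (a : OrthonormalBasis n ℂ (EuclideanSpace ℂ n)) : unitaryGroup n ℂ :=
  ⟨(EuclideanSpace.basisFun n ℂ).toBasis.toMatrix a,
    (EuclideanSpace.basisFun n ℂ).toMatrix_orthonormalBasis_mem_unitary a⟩

theorem unitaryOfBasis_apply (a : OrthonormalBasis n ℂ (EuclideanSpace ℂ n)) (r i : n) :
    (unitaryOfBasis a).1 r i = a i r := rfl

theorem unitaryOfBasis_surjective :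
    Function.Surjective (unitaryOfBasis : OrthonormalBasis n ℂ (EuclideanSpace ℂ n) → _) := by
  intro U
  have hon : Orthonormal ℂ fun i => (WithLp.toLp 2 fun r => U.1 r i : EuclideanSpace ℂ n) := by
    rw [orthonormal_iff_ite]
    intro i j
    have h := congrFun (congrFun (mem_unitaryGroup_iff'.mp U.2) i) j
    rw [mul_apply, one_apply] at h
    rw [← h]
    simp [PiLp.inner_apply, mul_comm]
  refine ⟨OrthonormalBasis.mk hon
    (hon.linearIndependent.span_eq_top_of_card_eq_finrank' (by simp)).ge, ?_⟩
  ext r i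
  rw [unitaryOfBasis_apply, OrthonormalBasis.coe_mk]

theorem ccMatrix_eq_ccOfUnitary
    (a : OrthonormalBasis (Fin N₁) ℂ (EuclideanSpace ℂ (Fin N₁)))
    (b : OrthonormalBasis (Fin N₂) ℂ (EuclideanSpace ℂ (Fin N₂))) (p : Fin N₁ × Fin N₂ → ℝ) :
    ccMatrix a b p = ccOfUnitary (unitaryOfBasis a) (unitaryOfBasis b) p := by
  ext ⟨r, s⟩ ⟨r', s'⟩
  simp only [ccMatrix, ccOfUnitary, unitaryKronecker, Unitary.conjStarAlgAut_apply, mul_apply,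
    diagonal_apply, Matrix.sum_apply, Matrix.smul_apply, kronecker_apply, ketBra, of_apply,
    Fintype.sum_prod_type, Matrix.star_apply, unitaryOfBasis_apply, mul_ite, mul_zero]
  refine Finset.sum_congr rfl fun i _ => Finset.sum_congr rfl fun j _ => ?_
  rw [Finset.sum_eq_single i, Finset.sum_eq_single j]
  · simp
    ring
  · intro j' _ h
    simp [h]
  · simp
  · intro i' _ h
    simp [h]
  · simp

/-- CC states are parametrized by two unitary matrices, which form compact groups, and a
distribution. -/
theorem mem_ccStates_iff {ρ : DensityMatrix N₁ N₂} :
    ρ ∈ ccStates N₁ N₂ ↔ ∃ (U : unitaryGroup (Fin N₁) ℂ) (V : unitaryGroup (Fin N₂) ℂ),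
      ∃ p ∈ stdSimplex ℝ (Fin N₁ × Fin N₂), ρ.1 = ccOfUnitary U V p := by
  constructor
  · rintro ⟨a, b, p, hp, h⟩
    exact ⟨_, _, p, hp, h.trans (ccMatrix_eq_ccOfUnitary a b p)⟩
  · rintro ⟨U, V, p, hp, h⟩
    obtain ⟨a, rfl⟩ := unitaryOfBasis_surjective U
    obtain ⟨b, rfl⟩ := unitaryOfBasis_surjective V
    exact ⟨a, b, p, hp, h.trans (ccMatrix_eq_ccOfUnitary a b p).symm⟩

theorem posSemidef_unitaryConj (U : unitaryGroup n ℂ) {A : Matrix n n ℂ} (hA : A.PosSemidef) :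
    (unitaryConj U A).PosSemidef :=
  hA.mul_mul_conjTranspose_same U.1

theorem trace_unitaryConj (U : unitaryGroup n ℂ) (A : Matrix n n ℂ) :
    (unitaryConj U A).trace = A.trace := by
  rw [Unitary.conjStarAlgAut_apply, trace_mul_comm, ← mul_assoc, Unitary.coe_star_mul_self,
    one_mul]

theorem charpoly_unitaryConj (U : unitaryGroup n ℂ) (A : Matrix n n ℂ) :
    (unitaryConj U A).charpoly = A.charpoly := by
  rw [Unitary.conjStarAlgAut_apply, charpoly_mul_comm, ← mul_assoc, Unitary.coe_star_mul_self,
    one_mul]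

theorem unitaryConj_mem_suAlg (U : unitaryGroup n ℂ) {X : Matrix n n ℂ} (hX : X ∈ suAlg n) :
    unitaryConj U X ∈ suAlg n := by
  refine ⟨?_, (trace_unitaryConj U X).trans hX.2⟩
  rw [← star_eq_conjTranspose, ← map_star, star_eq_conjTranspose, hX.1, map_neg]

theorem ccOfUnitary_posSemidef (U : unitaryGroup (Fin N₁) ℂ) (V : unitaryGroup (Fin N₂) ℂ)
    {p : Fin N₁ × Fin N₂ → ℝ} (hp : p ∈ stdSimplex ℝ (Fin N₁ × Fin N₂)) :
    (ccOfUnitary U V p).PosSemidef :=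
  posSemidef_unitaryConj _ (PosSemidef.diagonal fun k => by simpa using hp.1 k)

theorem trace_ccOfUnitary (U : unitaryGroup (Fin N₁) ℂ) (V : unitaryGroup (Fin N₂) ℂ)
    {p : Fin N₁ × Fin N₂ → ℝ} (hp : p ∈ stdSimplex ℝ (Fin N₁ × Fin N₂)) :
    (ccOfUnitary U V p).trace = 1 := by
  rw [ccOfUnitary, trace_unitaryConj, trace_diagonal, ← Complex.ofReal_sum, hp.2,
    Complex.ofReal_one]

theorem unitaryConj_kronecker (U : unitaryGroup (Fin N₁) ℂ) (V : unitaryGroup (Fin N₂) ℂ)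
    (A : Matrix (Fin N₁) (Fin N₁) ℂ) (B : Matrix (Fin N₂) (Fin N₂) ℂ) :
    unitaryConj (unitaryKronecker U V) (A ⊗ₖ B) = unitaryConj U A ⊗ₖ unitaryConj V B := by
  simp only [Unitary.conjStarAlgAut_apply, unitaryKronecker, star_eq_conjTranspose,
    conjTranspose_kronecker, mul_kronecker_mul]

theorem reducedFst_unitaryConj (U : unitaryGroup (Fin N₁) ℂ) (V : unitaryGroup (Fin N₂) ℂ)
    (M : Matrix (Fin N₁ × Fin N₂) (Fin N₁ × Fin N₂) ℂ) :
    reducedFst (unitaryConj (unitaryKronecker U V) M) = unitaryConj U (reducedFst M) := by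
  have h : unitaryConj (unitaryKronecker U V) M =
      (U.1 ⊗ₖ 1) * ((1 ⊗ₖ V.1) * (M * (1 ⊗ₖ V.1ᴴ))) * (U.1ᴴ ⊗ₖ 1) := by
    have h1 : U.1 ⊗ₖ V.1 = (U.1 ⊗ₖ 1) * (1 ⊗ₖ V.1) := by simp [← mul_kronecker_mul]
    have h2 : U.1ᴴ ⊗ₖ V.1ᴴ = (1 ⊗ₖ V.1ᴴ) * (U.1ᴴ ⊗ₖ 1) := by simp [← mul_kronecker_mul]
    change U.1 ⊗ₖ V.1 * M * (U.1 ⊗ₖ V.1)ᴴ = _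
    rw [conjTranspose_kronecker, h2, h1]
    simp only [mul_assoc]
  have hV : V.1ᴴ * V.1 = 1 := mem_unitaryGroup_iff'.mp V.2
  rw [h, reducedFst_mul_kronecker_one, reducedFst_kronecker_one_mul, reducedFst_one_kronecker_mul,
    mul_assoc M, ← mul_kronecker_mul, hV, one_mul, one_kronecker_one, mul_one]
  rfl

theorem reducedSnd_unitaryConj (U : unitaryGroup (Fin N₁) ℂ) (V : unitaryGroup (Fin N₂) ℂ)
    (M : Matrix (Fin N₁ × Fin N₂) (Fin N₁ × Fin N₂) ℂ) :
    reducedSnd (unitaryConj (unitaryKronecker U V) M) = unitaryConj V (reducedSnd M) := by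
  have h : unitaryConj (unitaryKronecker U V) M =
      (1 ⊗ₖ V.1) * ((U.1 ⊗ₖ 1) * (M * (U.1ᴴ ⊗ₖ 1))) * (1 ⊗ₖ V.1ᴴ) := by
    have h1 : U.1 ⊗ₖ V.1 = (1 ⊗ₖ V.1) * (U.1 ⊗ₖ 1) := by simp [← mul_kronecker_mul]
    have h2 : U.1ᴴ ⊗ₖ V.1ᴴ = (U.1ᴴ ⊗ₖ 1) * (1 ⊗ₖ V.1ᴴ) := by simp [← mul_kronecker_mul]
    change U.1 ⊗ₖ V.1 * M * (U.1 ⊗ₖ V.1)ᴴ = _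
    rw [conjTranspose_kronecker, h2, h1]
    simp only [mul_assoc]
  have hU : U.1ᴴ * U.1 = 1 := mem_unitaryGroup_iff'.mp U.2
  rw [h, reducedSnd_mul_one_kronecker, reducedSnd_one_kronecker_mul, reducedSnd_kronecker_one_mul,
    mul_assoc M, ← mul_kronecker_mul, hU, one_mul, one_kronecker_one, mul_one]
  rfl

/-- The first marginal of a function on pairs, as a linear map. -/
def marginalFst (N₁ N₂ : ℕ) : (Fin N₁ × Fin N₂ → ℝ) →ₗ[ℝ] (Fin N₁ → ℝ) where
  toFun p i := ∑ j, p (i, j)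
  map_add' p q := by ext; simp [Finset.sum_add_distrib]
  map_smul' c p := by ext; simp [Finset.mul_sum]

/-- The second marginal of a function on pairs, as a linear map. -/
def marginalSnd (N₁ N₂ : ℕ) : (Fin N₁ × Fin N₂ → ℝ) →ₗ[ℝ] (Fin N₂ → ℝ) where
  toFun p j := ∑ i, p (i, j)
  map_add' p q := by ext; simp [Finset.sum_add_distrib]
  map_smul' c p := by ext; simp [Finset.mul_sum]

theorem reducedFst_ccOfUnitary (U : unitaryGroup (Fin N₁) ℂ) (V : unitaryGroup (Fin N₂) ℂ)
    (p : Fin N₁ × Fin N₂ → ℝ) : reducedFst (ccOfUnitary U V p) =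
      unitaryConj U (diagonal fun i => (marginalFst N₁ N₂ p i : ℂ)) := by
  rw [ccOfUnitary, reducedFst_unitaryConj]
  congr 1
  ext i i'
  by_cases h : i = i' <;> simp [reducedFst, marginalFst, diagonal_apply, h]

theorem reducedSnd_ccOfUnitary (U : unitaryGroup (Fin N₁) ℂ) (V : unitaryGroup (Fin N₂) ℂ)
    (p : Fin N₁ × Fin N₂ → ℝ) : reducedSnd (ccOfUnitary U V p) =
      unitaryConj V (diagonal fun j => (marginalSnd N₁ N₂ p j : ℂ)) := by
  rw [ccOfUnitary, reducedSnd_unitaryConj]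
  congr 1
  ext j j'
  by_cases h : j = j' <;> simp [reducedSnd, marginalSnd, diagonal_apply, h]

theorem hasNondegenerateSpectrum_unitaryConj_diagonal {m : ℕ} (U : unitaryGroup (Fin m) ℂ)
    (d : Fin m → ℝ) :
    HasNondegenerateSpectrum (unitaryConj U (diagonal fun i => (d i : ℂ))) ↔
      Function.Injective d := by
  have h : (unitaryConj U (diagonal fun i => (d i : ℂ))).charpoly.roots =
      Finset.univ.val.map fun i => (d i : ℂ) := by
    rw [charpoly_unitaryConj, charpoly_diagonal]
    exact Polynomial.roots_multiset_prod_X_sub_C (Finset.univ.val.map fun i => (d i : ℂ)) ▸ by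
      rw [Multiset.map_map]; rfl
  rw [HasNondegenerateSpectrum, h, Multiset.nodup_map_iff_inj_on Finset.univ.nodup]
  simp [Function.Injective]

/-- The reduced matrices of a CC state are diagonal in the chosen bases, with the marginals of the
distribution as eigenvalues. -/
theorem hasNondegenerateMarginals_ccOfUnitary (U : unitaryGroup (Fin N₁) ℂ)
    (V : unitaryGroup (Fin N₂) ℂ) (p : Fin N₁ × Fin N₂ → ℝ) :
    HasNondegenerateMarginals (ccOfUnitary U V p) ↔
      Function.Injective (marginalFst N₁ N₂ p) ∧ Function.Injective (marginalSnd N₁ N₂ p) := by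
  rw [HasNondegenerateMarginals, reducedFst_ccOfUnitary, reducedSnd_ccOfUnitary,
    hasNondegenerateSpectrum_unitaryConj_diagonal, hasNondegenerateSpectrum_unitaryConj_diagonal]

end Unitaries

/-! ### Symplectic orbits and CC states -/

section Orbits

variable {n : Type*} [Fintype n] [DecidableEq n] {N₁ N₂ : ℕ}

theorem sub_mul_apply_eq_zero_of_commute_diagonal {d : n → ℂ} {A : Matrix n n ℂ}
    (h : Commute (diagonal d) A) (i j : n) : (d i - d j) * A i j = 0 := by
  have := congrFun (congrFun h.eq i) j
  rw [diagonal_mul, mul_diagonal] at this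
  linear_combination this

theorem eq_diagonal_of_commute {d : n → ℂ} (hd : Function.Injective d) {A : Matrix n n ℂ}
    (h : Commute (diagonal d) A) : A = diagonal A.diag := by
  ext i j
  by_cases hij : i = j
  · simp [hij]
  · rw [diagonal_apply_ne _ hij]
    exact (mul_eq_zero.mp (sub_mul_apply_eq_zero_of_commute_diagonal h i j)).resolve_left
      (sub_ne_zero.mpr (hd.ne hij))

/-- A matrix commuting with a hermitian matrix of simple spectrum is diagonal in an
eigenbasis of the latter. -/
theorem exists_eq_unitaryConj_diagonal (U : unitaryGroup n ℂ) {d : n → ℝ}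
    (hd : Function.Injective d) {X : Matrix n n ℂ}
    (h : Commute X (unitaryConj U (diagonal fun i => (d i : ℂ)))) :
    ∃ x : n → ℂ, X = unitaryConj U (diagonal x) := by
  have h' := (h.map (unitaryConj U).symm).symm
  rw [StarAlgEquiv.symm_apply_apply] at h'
  have := eq_diagonal_of_commute (fun i j hij => hd (Complex.ofReal_injective hij)) h'
  exact ⟨_, by rw [← this, StarAlgEquiv.apply_symm_apply]⟩

theorem commute_diagonal_diagonal (x y : n → ℂ) : Commute (diagonal x) (diagonal y) := by
  rw [Commute, SemiconjBy, diagonal_mul_diagonal, diagonal_mul_diagonal]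
  simp only [mul_comm]

/-- When the reduced matrices of a CC state have simple spectra, the local generators that fix
them are diagonal in the same product basis as the state, hence fix the state. -/
theorem commute_ccOfUnitary_of_commute_reduced (U : unitaryGroup (Fin N₁) ℂ)
    (V : unitaryGroup (Fin N₂) ℂ) {p : Fin N₁ × Fin N₂ → ℝ}
    (hp : HasNondegenerateMarginals (ccOfUnitary U V p))
    {X₁ : Matrix (Fin N₁) (Fin N₁) ℂ} {X₂ : Matrix (Fin N₂) (Fin N₂) ℂ}
    (h₁ : Commute X₁ (reducedFst (ccOfUnitary U V p)))
    (h₂ : Commute X₂ (reducedSnd (ccOfUnitary U V p))) :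
    Commute (X₁ ⊗ₖ 1 + 1 ⊗ₖ X₂) (ccOfUnitary U V p) := by
  rw [hasNondegenerateMarginals_ccOfUnitary] at hp
  rw [reducedFst_ccOfUnitary] at h₁
  rw [reducedSnd_ccOfUnitary] at h₂
  obtain ⟨x, rfl⟩ := exists_eq_unitaryConj_diagonal U hp.1 h₁
  obtain ⟨y, rfl⟩ := exists_eq_unitaryConj_diagonal V hp.2 h₂
  rw [ccOfUnitary, ← map_one (unitaryConj U), ← map_one (unitaryConj V), ← unitaryConj_kronecker,
    ← unitaryConj_kronecker, ← map_add]
  refine Commute.map ?_ _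
  rw [← diagonal_one, ← diagonal_one, diagonal_kronecker_diagonal, diagonal_kronecker_diagonal,
    diagonal_add]
  exact commute_diagonal_diagonal _ _

/-- The hypothesis is needed only at `ρ`: conjugating by a local unitary changes the bases but not
the distribution, and the distribution decides whether the marginals are degenerate. -/
theorem isSymplecticOrbit_of_hasNondegenerateMarginals {ρ : DensityMatrix N₁ N₂}
    (hρ : ρ ∈ ccStates N₁ N₂) (h : HasNondegenerateMarginals ρ.1) : IsSymplecticOrbit ρ := by
  obtain ⟨U, V, p, -, hp⟩ := mem_ccStates_iff.mp hρ
  rintro σ ⟨U', hU', V', hV', hσ⟩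
  have hσ' : σ.1 = ccOfUnitary (⟨U', (mem_specialUnitaryGroup_iff.mp hU').1⟩ * U)
      (⟨V', (mem_specialUnitaryGroup_iff.mp hV').1⟩ * V) p := by
    rw [ccOfUnitary, unitaryKronecker_mul, Unitary.conjStarAlgAut_mul_apply, hσ, hp]
    rfl
  rw [nondegenerate_restrict_iff, hσ']
  intro X₁ _ X₂ _ h₁ h₂
  refine commute_ccOfUnitary_of_commute_reduced _ _ ?_ h₁ h₂
  rw [hasNondegenerateMarginals_ccOfUnitary]
  rwa [hp, hasNondegenerateMarginals_ccOfUnitary] at h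

/-- The traceless anti-hermitian matrix `i (|k⟩⟨k| - |l⟩⟨l|)`. -/
def diagGenerator (k l : n) : Matrix n n ℂ :=
  diagonal (Pi.single k Complex.I - Pi.single l Complex.I)

theorem diagGenerator_mem_suAlg (k l : n) : diagGenerator k l ∈ suAlg n := by
  refine ⟨?_, ?_⟩
  · rw [diagGenerator, diagonal_conjTranspose]
    refine Eq.trans (congrArg diagonal ?_) (diagonal_neg _).symm
    ext i
    simp only [Pi.star_apply, Pi.sub_apply, Pi.single_apply]
    split_ifs <;> simp
  · simp [diagGenerator, trace_diagonal, Finset.sum_sub_distrib]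

/-- If every local infinitesimal unitary that fixes the reduced matrices of `σ` fixes `σ`,
then `σ` is a CC state: in a product of eigenbases of the reduced matrices, `σ` commutes
with all diagonal local generators, hence is diagonal. -/
theorem mem_ccStates_of_commute (σ : DensityMatrix N₁ N₂)
    (h : ∀ X₁ ∈ suAlg (Fin N₁), ∀ X₂ ∈ suAlg (Fin N₂), Commute X₁ (reducedFst σ.1) →
        Commute X₂ (reducedSnd σ.1) → Commute (X₁ ⊗ₖ 1 + 1 ⊗ₖ X₂) σ.1) :
    σ ∈ ccStates N₁ N₂ := by
  have hσ : σ.1.IsHermitian := σ.2.1.isHermitian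
  have h₁ : (reducedFst σ.1).IsHermitian :=
    (conjTranspose_reducedFst _).trans (congrArg reducedFst hσ.eq)
  have h₂ : (reducedSnd σ.1).IsHermitian :=
    (conjTranspose_reducedSnd _).trans (congrArg reducedSnd hσ.eq)
  set U := h₁.eigenvectorUnitary
  set V := h₂.eigenvectorUnitary
  set τ := (unitaryConj (unitaryKronecker U V)).symm σ.1 with hτ
  have hστ : σ.1 = unitaryConj (unitaryKronecker U V) τ := by
    rw [hτ, StarAlgEquiv.apply_symm_apply]
  have hτpos : τ.PosSemidef := by
    rw [hτ, Unitary.conjStarAlgAut_symm]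
    exact posSemidef_unitaryConj _ σ.2.1
  have hτtr : τ.trace = 1 := by
    rw [← trace_unitaryConj (unitaryKronecker U V), ← hστ, σ.2.2]
  have hcomm : ∀ x ∈ suAlg (Fin N₁), ∀ y ∈ suAlg (Fin N₂), ∀ x' y', x = diagonal x' →
      y = diagonal y' → Commute (x ⊗ₖ 1 + 1 ⊗ₖ y) τ := by
    rintro x hx y hy x' y' rfl rfl
    have h0 := h _ (unitaryConj_mem_suAlg U hx) _ (unitaryConj_mem_suAlg V hy)
      (by
        rw [h₁.spectral_theorem]
        exact (commute_diagonal_diagonal _ _).map _)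
      (by
        rw [h₂.spectral_theorem]
        exact (commute_diagonal_diagonal _ _).map _)
    rw [← map_one (unitaryConj U), ← map_one (unitaryConj V), ← unitaryConj_kronecker,
      ← unitaryConj_kronecker, ← map_add] at h0
    have h0' := h0.map (unitaryConj (unitaryKronecker U V)).symm
    rwa [StarAlgEquiv.symm_apply_apply] at h0'
  have hoff₁ : ∀ (i i' : Fin N₁) (j j' : Fin N₂), i ≠ i' → τ (i, j) (i', j') = 0 := by
    intro i i' j j' hii
    have hc := hcomm _ (diagGenerator_mem_suAlg i i') 0 (zero_mem _) _ 0 rfl diagonal_zero.symm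
    rw [kronecker_zero, add_zero, diagGenerator, ← diagonal_one, diagonal_kronecker_diagonal] at hc
    have := sub_mul_apply_eq_zero_of_commute_diagonal hc (i, j) (i', j')
    simpa [hii, hii.symm, sub_eq_zero, Complex.ext_iff] using this
  have hoff₂ : ∀ (i i' : Fin N₁) (j j' : Fin N₂), j ≠ j' → τ (i, j) (i', j') = 0 := by
    intro i i' j j' hjj
    have hc := hcomm 0 (zero_mem _) _ (diagGenerator_mem_suAlg j j') 0 _ diagonal_zero.symm rfl
    rw [zero_kronecker, zero_add, diagGenerator, ← diagonal_one, diagonal_kronecker_diagonal] at hc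
    have := sub_mul_apply_eq_zero_of_commute_diagonal hc (i, j) (i', j')
    simpa [hjj, hjj.symm, sub_eq_zero, Complex.ext_iff] using this
  -- The diagonal entries of a positive semidefinite matrix are real.
  have hre : ∀ k, ((τ k k).re : ℂ) = τ k k := fun k =>
    Complex.ext rfl (Complex.nonneg_iff.mp hτpos.diag_nonneg).2
  have hdiag : τ = diagonal fun k => ((τ k k).re : ℂ) := by
    ext ⟨i, j⟩ ⟨i', j'⟩
    by_cases hk : (i, j) = (i', j')
    · rw [hk, diagonal_apply_eq, hre]
    · rw [diagonal_apply_ne _ hk]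
      by_cases hi : i = i'
      · exact hoff₂ _ _ _ _ fun hj => hk (by rw [hi, hj])
      · exact hoff₁ _ _ _ _ hi
  refine mem_ccStates_iff.mpr ⟨U, V, fun k => (τ k k).re, ⟨fun k =>
    (Complex.nonneg_iff.mp hτpos.diag_nonneg).1, ?_⟩, ?_⟩
  · have := congrArg Complex.re hτtr
    simpa [Matrix.trace] using this
  · rw [ccOfUnitary, ← hdiag, hστ]

theorem localOrbit_subset_ccStates {ρ : DensityMatrix N₁ N₂} (hρ : IsSymplecticOrbit ρ) :
    localOrbit ρ ⊆ ccStates N₁ N₂ := fun σ hσ =>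
  mem_ccStates_of_commute σ ((nondegenerate_restrict_iff σ).mp (hρ σ hσ))

theorem mem_localOrbit_self (ρ : DensityMatrix N₁ N₂) : ρ ∈ localOrbit ρ :=
  ⟨1, one_mem _, 1, one_mem _, by simp⟩

end Orbits

/-! ### Genericity -/

section Generic

variable {N₁ N₂ : ℕ}

instance compactSpace_unitaryGroup {n : Type*} [Fintype n] [DecidableEq n] :
    CompactSpace (unitaryGroup n ℂ) := by
  refine isCompact_iff_compactSpace.mp ?_
  have hc : IsCompact (Set.univ.pi fun _ : n => Set.univ.pi fun _ : n =>
      Metric.closedBall (0 : ℂ) 1) :=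
    isCompact_univ_pi fun _ => isCompact_univ_pi fun _ => isCompact_closedBall _ _
  refine hc.of_isClosed_subset (isClosed_unitary (R := Matrix n n ℂ)) fun U hU i _ j _ => ?_
  simpa using entry_norm_bound_of_unitary hU i j

theorem continuous_ccOfUnitary :
    Continuous fun x : (unitaryGroup (Fin N₁) ℂ × unitaryGroup (Fin N₂) ℂ) ×
      (Fin N₁ × Fin N₂ → ℝ) => ccOfUnitary x.1.1 x.1.2 x.2 := by
  refine continuous_matrix fun k l => ?_
  simp only [ccOfUnitary, unitaryKronecker, Unitary.conjStarAlgAut_apply, mul_apply,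
    diagonal_apply, kroneckerMap_apply, Matrix.star_apply, mul_ite, mul_zero, Finset.sum_ite_eq',
    Finset.mem_univ, if_true]
  have h1 : ∀ i j, Continuous fun x : (unitaryGroup (Fin N₁) ℂ × unitaryGroup (Fin N₂) ℂ) ×
      (Fin N₁ × Fin N₂ → ℝ) => x.1.1.1 i j := fun i j =>
    (continuous_subtype_val.comp (continuous_fst.comp continuous_fst)).matrix_elem i j
  have h2 : ∀ i j, Continuous fun x : (unitaryGroup (Fin N₁) ℂ × unitaryGroup (Fin N₂) ℂ) ×
      (Fin N₁ × Fin N₂ → ℝ) => x.1.2.1 i j := fun i j =>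
    (continuous_subtype_val.comp (continuous_snd.comp continuous_fst)).matrix_elem i j
  refine continuous_finsetSum _ fun m _ => ?_
  exact (((h1 _ _).mul (h2 _ _)).mul (Complex.continuous_ofReal.comp
    ((continuous_apply m).comp continuous_snd))).mul
      (continuous_star.comp ((h1 _ _).mul (h2 _ _)))

/-- The CC states whose distribution, in some pair of orthonormal bases, lies in a closed subset of
the simplex form a closed set, by compactness of the unitary groups. -/
theorem isClosed_setOf_ccOfUnitary {S : Set (Fin N₁ × Fin N₂ → ℝ)} (hS : IsClosed S) :
    IsClosed {ρ : DensityMatrix N₁ N₂ | ∃ (U : unitaryGroup (Fin N₁) ℂ)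
      (V : unitaryGroup (Fin N₂) ℂ), ∃ p ∈ stdSimplex ℝ (Fin N₁ × Fin N₂) ∩ S,
        ρ.1 = ccOfUnitary U V p} := by
  have hK := ((isCompact_univ (X := unitaryGroup (Fin N₁) ℂ × unitaryGroup (Fin N₂) ℂ)).prod
    ((isCompact_stdSimplex ℝ (Fin N₁ × Fin N₂)).inter_right hS)).image continuous_ccOfUnitary
  convert hK.isClosed.preimage
    (continuous_subtype_val : Continuous (Subtype.val : DensityMatrix N₁ N₂ → _)) using 1
  ext ρ
  constructor
  · rintro ⟨U, V, p, hp, h⟩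
    exact ⟨((U, V), p), ⟨trivial, hp⟩, h.symm⟩
  · rintro ⟨⟨⟨U, V⟩, p⟩, ⟨-, hp⟩, h⟩
    exact ⟨U, V, p, hp, h.symm⟩

theorem isClosed_ccStates : IsClosed (ccStates N₁ N₂) := by
  convert isClosed_setOf_ccOfUnitary (N₁ := N₁) (N₂ := N₂) isClosed_univ using 1
  ext ρ
  simp [mem_ccStates_iff]

theorem isClosed_setOf_not_injective {ι X : Type*} [Finite ι] [TopologicalSpace X]
    {f : X → ι → ℝ} (hf : Continuous f) : IsClosed {x | ¬ Function.Injective (f x)} := by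
  have : {x | ¬ Function.Injective (f x)} =
      ⋃ (i : ι) (j : ι), {x | f x i = f x j ∧ i ≠ j} := by
    ext x
    simp [Function.Injective]
  rw [this]
  refine isClosed_iUnion_of_finite fun i => isClosed_iUnion_of_finite fun j => ?_
  by_cases hij : i = j
  · simp [hij]
  · simpa [hij] using isClosed_eq ((continuous_apply i).comp hf) ((continuous_apply j).comp hf)

/-- The complement consists of the CC states whose distribution has a non-injective marginal,
a closed condition on the distribution. -/
theorem isOpen_hasNondegenerateMarginals :
    IsOpen {ρ : ccStates N₁ N₂ | HasNondegenerateMarginals ρ.1.1} := by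
  have hS : IsClosed {p : Fin N₁ × Fin N₂ → ℝ | ¬ Function.Injective (marginalFst N₁ N₂ p) ∨
      ¬ Function.Injective (marginalSnd N₁ N₂ p)} :=
    (isClosed_setOf_not_injective (LinearMap.continuous_of_finiteDimensional _)).union
      (isClosed_setOf_not_injective (LinearMap.continuous_of_finiteDimensional _))
  rw [← isClosed_compl_iff]
  convert (isClosed_setOf_ccOfUnitary hS).preimage
    (continuous_subtype_val : Continuous (Subtype.val : ccStates N₁ N₂ → _)) using 1
  ext ⟨ρ, hρ⟩
  constructor
  · intro h
    obtain ⟨U, V, p, hp, hρp⟩ := mem_ccStates_iff.mp hρ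
    refine ⟨U, V, p, ⟨hp, ?_⟩, hρp⟩
    change ¬ HasNondegenerateMarginals ρ.1 at h
    rwa [hρp, hasNondegenerateMarginals_ccOfUnitary, not_and_or] at h
  · rintro ⟨U, V, p, ⟨-, hp⟩, hρp⟩
    change ρ.1 = _ at hρp
    change ¬ HasNondegenerateMarginals ρ.1
    rwa [hρp, hasNondegenerateMarginals_ccOfUnitary, not_and_or]

/-- On a non-empty simplex there is a distribution with two injective marginals: the one
proportional to `i + j + 1`. -/
theorem exists_injective_marginals (h₁ : 0 < N₁) (h₂ : 0 < N₂) :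
    ∃ q ∈ stdSimplex ℝ (Fin N₁ × Fin N₂), Function.Injective (marginalFst N₁ N₂ q) ∧
      Function.Injective (marginalSnd N₁ N₂ q) := by
  have := Fin.pos_iff_nonempty.mp h₁
  have := Fin.pos_iff_nonempty.mp h₂
  let w : Fin N₁ × Fin N₂ → ℝ := fun k => k.1 + k.2 + 1
  have hw : ∀ k, 0 < w k := fun k => by positivity
  have hs : 0 < ∑ k, w k := Finset.sum_pos (fun k _ => hw k) Finset.univ_nonempty
  have hN₁ : (N₁ : ℝ) ≠ 0 := by positivity
  have hN₂ : (N₂ : ℝ) ≠ 0 := by positivity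
  refine ⟨(∑ k, w k)⁻¹ • w, ⟨fun k => ?_, ?_⟩, ?_, ?_⟩
  · exact mul_nonneg (inv_nonneg.mpr hs.le) (hw k).le
  · simp only [Pi.smul_apply, smul_eq_mul, ← Finset.mul_sum]
    exact inv_mul_cancel₀ hs.ne'
  · intro i i' h
    rw [map_smul] at h
    have h' := mul_left_cancel₀ (inv_ne_zero hs.ne') h
    simpa [marginalFst, w, hN₂, Finset.sum_add_distrib, Fin.val_inj] using h'
  · intro j j' h
    rw [map_smul] at h
    have h' := mul_left_cancel₀ (inv_ne_zero hs.ne') h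
    simpa [marginalSnd, w, hN₁, Finset.sum_add_distrib, Fin.val_inj] using h'

/-- A small displacement of `x` in the direction of an injective function is injective. -/
theorem eventually_injective_segment {ι : Type*} [Finite ι] (x y : ι → ℝ)
    (hy : Function.Injective y) :
    ∀ᶠ ε in nhdsWithin (0 : ℝ) (Set.Ioi 0),
      Function.Injective ((1 - ε) • x + ε • y) := by
  have key : ∀ i j, ∀ᶠ ε in nhdsWithin (0 : ℝ) (Set.Ioi 0), i ≠ j →
      ((1 - ε) • x + ε • y) i ≠ ((1 - ε) • x + ε • y) j := by
    intro i j
    by_cases hx : x i = x j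
    · filter_upwards [self_mem_nhdsWithin] with ε hε hij h
      simp only [Pi.add_apply, Pi.smul_apply, smul_eq_mul, hx, add_right_inj] at h
      exact hy.ne hij (mul_left_cancel₀ (ne_of_gt hε) h)
    · have hc : Continuous fun ε : ℝ =>
          ((1 - ε) • x + ε • y) i - ((1 - ε) • x + ε • y) j := by
        simp only [Pi.add_apply, Pi.smul_apply, smul_eq_mul]
        fun_prop
      have h0 := hc.continuousAt.eventually_ne (x := 0) (y := 0) (by simpa [sub_eq_zero] using hx)
      filter_upwards [nhdsWithin_le_nhds h0] with ε hε _
      exact sub_ne_zero.mp hε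
  filter_upwards [Filter.eventually_all.mpr fun i => Filter.eventually_all.mpr (key i)] with ε hε
  intro i j h
  by_contra hij
  exact hε i j hij h

theorem pos_of_mem_stdSimplex {p : Fin N₁ × Fin N₂ → ℝ}
    (hp : p ∈ stdSimplex ℝ (Fin N₁ × Fin N₂)) : 0 < N₁ ∧ 0 < N₂ := by
  obtain ⟨k⟩ : Nonempty (Fin N₁ × Fin N₂) := by
    by_contra h
    rw [not_nonempty_iff] at h
    simpa using hp.2
  exact ⟨k.1.pos, k.2.pos⟩

/-- The approximating distributions lie on the segment from `p` to a distribution with injective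
marginals. -/
theorem ccOfUnitary_mem_closure (U : unitaryGroup (Fin N₁) ℂ) (V : unitaryGroup (Fin N₂) ℂ)
    {p : Fin N₁ × Fin N₂ → ℝ} (hp : p ∈ stdSimplex ℝ (Fin N₁ × Fin N₂)) :
    ccOfUnitary U V p ∈ closure (ccOfUnitary U V '' {p' ∈ stdSimplex ℝ (Fin N₁ × Fin N₂) |
      HasNondegenerateMarginals (ccOfUnitary U V p')}) := by
  obtain ⟨h₁, h₂⟩ := pos_of_mem_stdSimplex hp
  obtain ⟨q, hq, hq₁, hq₂⟩ := exists_injective_marginals h₁ h₂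
  have hc : Continuous (ccOfUnitary U V) :=
    Continuous.comp (f := fun p => ((U, V), p)) continuous_ccOfUnitary (by fun_prop)
  refine image_closure_subset_closure_image hc (Set.mem_image_of_mem _ ?_)
  have hline : Continuous fun ε : ℝ => (1 - ε) • p + ε • q := by fun_prop
  have ht : Filter.Tendsto (fun ε : ℝ => (1 - ε) • p + ε • q)
      (nhdsWithin 0 (Set.Ioi 0)) (nhds p) := by
    simpa using (hline.tendsto 0).mono_left nhdsWithin_le_nhds
  refine mem_closure_of_tendsto ht ?_
  filter_upwards [eventually_injective_segment (marginalFst N₁ N₂ p) _ hq₁,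
    eventually_injective_segment (marginalSnd N₁ N₂ p) _ hq₂,
    self_mem_nhdsWithin, nhdsWithin_le_nhds (Iio_mem_nhds one_pos)] with ε he₁ he₂ hε hε1
  refine ⟨convex_stdSimplex ℝ _ hp hq (sub_nonneg.mpr (le_of_lt hε1)) (le_of_lt hε) (by ring),
    (hasNondegenerateMarginals_ccOfUnitary U V _).mpr ⟨?_, ?_⟩⟩
  · simpa only [map_add, map_smul] using he₁
  · simpa only [map_add, map_smul] using he₂

theorem dense_hasNondegenerateMarginals :
    Dense {ρ : ccStates N₁ N₂ | HasNondegenerateMarginals ρ.1.1} := by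
  intro ρ
  obtain ⟨U, V, p, hp, hρp⟩ := mem_ccStates_iff.mp ρ.2
  rw [closure_subtype, closure_subtype]
  refine closure_mono ?_ (hρp ▸ ccOfUnitary_mem_closure U V hp :)
  rintro M ⟨p', ⟨hp', hnd⟩, hM⟩
  let τ : DensityMatrix N₁ N₂ := ⟨ccOfUnitary U V p',
    ccOfUnitary_posSemidef U V hp', trace_ccOfUnitary U V hp'⟩
  have hτ : τ ∈ ccStates N₁ N₂ := mem_ccStates_iff.mpr ⟨U, V, p', hp', rfl⟩
  exact ⟨τ, ⟨⟨τ, hτ⟩, hnd, rfl⟩, hM⟩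

/-- For fixed bases, the degenerate distributions lie on the hyperplanes on which two entries of
one of the marginals agree. -/
theorem exists_finset_dual_hasNondegenerateMarginals (U : unitaryGroup (Fin N₁) ℂ)
    (V : unitaryGroup (Fin N₂) ℂ) :
    ∃ F : Finset (Module.Dual ℝ (Fin N₁ × Fin N₂ → ℝ)),
      (∀ l ∈ F, ∃ p ∈ stdSimplex ℝ (Fin N₁ × Fin N₂), l p ≠ 0) ∧
      ∀ p ∈ stdSimplex ℝ (Fin N₁ × Fin N₂),
        HasNondegenerateMarginals (ccOfUnitary U V p) ↔ ∀ l ∈ F, l p ≠ 0 := by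
  classical
  by_cases hN : (stdSimplex ℝ (Fin N₁ × Fin N₂)).Nonempty
  swap
  -- If one factor has dimension zero, the simplex is empty and no functional is needed.
  · exact ⟨∅, by simp, fun p hp => absurd ⟨p, hp⟩ hN⟩
  obtain ⟨p₀, hp₀⟩ := hN
  obtain ⟨h₁, h₂⟩ := pos_of_mem_stdSimplex hp₀
  obtain ⟨q, hq, hq₁, hq₂⟩ := exists_injective_marginals h₁ h₂
  let f : Fin N₁ × Fin N₁ → Module.Dual ℝ (Fin N₁ × Fin N₂ → ℝ) := fun k =>
    (LinearMap.proj (R := ℝ) (φ := fun _ => ℝ) k.1 - LinearMap.proj k.2) ∘ₗ marginalFst N₁ N₂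
  let g : Fin N₂ × Fin N₂ → Module.Dual ℝ (Fin N₁ × Fin N₂ → ℝ) := fun k =>
    (LinearMap.proj (R := ℝ) (φ := fun _ => ℝ) k.1 - LinearMap.proj k.2) ∘ₗ marginalSnd N₁ N₂
  have hf : ∀ p : Fin N₁ × Fin N₂ → ℝ, (∀ k ∈ Finset.univ.offDiag, f k p ≠ 0) ↔
      Function.Injective (marginalFst N₁ N₂ p) := by
    intro p
    simp only [Finset.mem_offDiag, Finset.mem_univ, true_and, Prod.forall, f, LinearMap.comp_apply,
      LinearMap.sub_apply, LinearMap.proj_apply, sub_ne_zero]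
    exact ⟨fun h i j hij => by_contra fun hne => h i j hne hij, fun h i j hij => h.ne hij⟩
  have hg : ∀ p : Fin N₁ × Fin N₂ → ℝ, (∀ k ∈ Finset.univ.offDiag, g k p ≠ 0) ↔
      Function.Injective (marginalSnd N₁ N₂ p) := by
    intro p
    simp only [Finset.mem_offDiag, Finset.mem_univ, true_and, Prod.forall, g, LinearMap.comp_apply,
      LinearMap.sub_apply, LinearMap.proj_apply, sub_ne_zero]
    exact ⟨fun h i j hij => by_contra fun hne => h i j hne hij, fun h i j hij => h.ne hij⟩
  have hF : ∀ p : Fin N₁ × Fin N₂ → ℝ,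
      (∀ l ∈ Finset.univ.offDiag.image f ∪ Finset.univ.offDiag.image g, l p ≠ 0) ↔
      Function.Injective (marginalFst N₁ N₂ p) ∧ Function.Injective (marginalSnd N₁ N₂ p) := by
    intro p
    rw [← hf, ← hg, Finset.forall_mem_union, Finset.forall_mem_image, Finset.forall_mem_image]
  exact ⟨_, fun l hl => ⟨q, hq, (hF q).mpr ⟨hq₁, hq₂⟩ l hl⟩, fun p _ =>
    (hasNondegenerateMarginals_ccOfUnitary U V p).trans (hF p).symm⟩

theorem ccStates_eq_closure : ccStates N₁ N₂ =
    closure (⋃ ρ ∈ {ρ : DensityMatrix N₁ N₂ | IsSymplecticOrbit ρ}, localOrbit ρ) := by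
  refine Set.Subset.antisymm (fun ρ hρ => ?_) ?_
  · have h := dense_hasNondegenerateMarginals (⟨ρ, hρ⟩ : ccStates N₁ N₂)
    rw [closure_subtype] at h
    refine closure_mono ?_ h
    rintro _ ⟨σ, hσ, rfl⟩
    exact Set.mem_biUnion (isSymplecticOrbit_of_hasNondegenerateMarginals σ.2 hσ)
      (mem_localOrbit_self σ.1)
  · exact closure_minimal (Set.iUnion₂_subset fun ρ hρ => localOrbit_subset_ccStates hρ)
      isClosed_ccStates

end Generic

end

theorem mainTheorem7 (N₁ N₂ : ℕ) :
    -- genericity in the space of all CC states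
    (IsOpen {ρ : ccStates N₁ N₂ | HasNondegenerateMarginals ρ.1.1} ∧
      Dense {ρ : ccStates N₁ N₂ | HasNondegenerateMarginals ρ.1.1}) ∧
    -- genericity among the CC states with fixed bases: off finitely many proper hyperplanes
    (∀ (a : OrthonormalBasis (Fin N₁) ℂ (EuclideanSpace ℂ (Fin N₁)))
      (b : OrthonormalBasis (Fin N₂) ℂ (EuclideanSpace ℂ (Fin N₂))),
      ∃ F : Finset (Module.Dual ℝ (Fin N₁ × Fin N₂ → ℝ)),
        (∀ l ∈ F, ∃ p ∈ stdSimplex ℝ (Fin N₁ × Fin N₂), l p ≠ 0) ∧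
        ∀ p ∈ stdSimplex ℝ (Fin N₁ × Fin N₂),
          HasNondegenerateMarginals (ccMatrix a b p) ↔ ∀ l ∈ F, l p ≠ 0) ∧
    -- symplectic orbits consist only of CC states
    (∀ ρ : DensityMatrix N₁ N₂, IsSymplecticOrbit ρ → localOrbit ρ ⊆ ccStates N₁ N₂) ∧
    -- the CC states are the closure of the union of all symplectic orbits
    ccStates N₁ N₂ = closure (⋃ ρ ∈ {ρ : DensityMatrix N₁ N₂ | IsSymplecticOrbit ρ}, localOrbit ρ) := by
  refine ⟨⟨isOpen_hasNondegenerateMarginals, dense_hasNondegenerateMarginals⟩, fun a b => ?_,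
    fun ρ hρ => localOrbit_subset_ccStates hρ, ccStates_eq_closure⟩
  simpa only [ccMatrix_eq_ccOfUnitary] using
    exists_finset_dual_hasNondegenerateMarginals (unitaryOfBasis a) (unitaryOfBasis b)
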